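/- Corollary 5.3. Let $n\ge 1$, let $a_1,\dots,a_n$ be nonzero integers (of arbitrary signs), and put $\varepsilon_k=\operatorname{sign}(a_k)\in\{1,-1\}$. Let $D$ be the standard (not necessarily alternating) diagram of the unoriented rational link encoded by the continued fraction $[0,a_1,\dots,a_n]$. It is the following 4-plat. Four horizontal strands, numbered $1,2,3,4$ from top to bottom, are closed on the left by joining $1$ with $2$ and $3$ with $4$. From left to right they pass through twist boxes $B_1,\dots,B_n$, where $B_k$ consists of $|a_k|$ consecutive half-turn crossings of the strands $2,3$ if $k$ is odd, and of the strands $1,2$ if $k$ is even. The over-strand of each crossing in $B_k$ goes from the lower left to the upper right if $(-1)^{k-1}a_k>0$, and from the upper left to the lower right if $(-1)^{k-1}a_k<0$. On the right, strand $1$ is joined with $2$ and $3$ with $4$ if $n$ is odd; $1$ is joined with $4$ and $2$ with $3$ if $n$ is even. Let $d=-A^2-A^{-2}$ and let $K_n=\langle D\rangle\in\mathbb Z[A,A^{-1}]$ be the Kauffman bracket $$\langle D\rangle=\sum_{s}A^{\alpha(s)-\beta(s)}\,d^{\,\ell(s)-1},$$ the sum being over all states $s$ (choices of an $A$- or $B$-smoothing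 at every crossing), where $\alpha(s)$ and $\beta(s)$ are the numbers of $A$- and $B$-smoothings and $\ell(s)$ is the number of loops; the $A$-smoothing of a crossing merges the two regions swept out when the over-strand is rotated counterclockwise. For an integer $m\ge 1$ write $[m]_q=1+q+\dots+q^{m-1}$. Then $K_n$ is the sum, over all tilings of a strip of $n$ unit cells, numbered $1,\dots,n$, by $1\times1$ and $2\times1$ tiles, of the product of the weights of the tiles, where: 1. a $1\times1$ tile in position $1$ has weight $A^{-a_1+2\varepsilon_1}\,[|a_1|]_{-A^{4\varepsilon_1}}+A^{-a_1}d$; 2. a $1\times1$ tile in position $k>1$ has weight $A^{(-1)^{k-1}(2\varepsilon_k-a_k)}\,[|a_k|]_{-A^{(-1)^{k-1}4\varepsilon_k}}$; 3. a $2\times1$ tile covering positions $k,k+1$ has weight $(-1)^{a_k}A^{(-1)^{k+1}(3a_k+a_{k+1})}$. -/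

import Mathlib

open scoped LaurentPolynomial

noncomputable section

/-! ### Unoriented link diagrams and the Kauffman bracket -/

/-- A planar diagram code of an unoriented link diagram. The strands of the diagram are cut into
finitely many elementary arcs (`Arc`). The pieces between the arcs are

* the crossings: `corner c 0, …, corner c 3` are the arcs at the four corners of the crossing `c`,
  listed counterclockwise, starting from one of the two ends of the under-strand; so the corners
  `0, 2` are the ends of the under-strand and the corners `1, 3` the ends of the over-strand;
* the joints: at the joint `j` the arcs `joint j 0` and `joint j 1` are glued end to end without
  any crossing.

Every arc has exactly two ends. -/
structure LinkDiagram where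
  Arc : Type
  Crossing : Type
  Joint : Type
  [finiteArc : Finite Arc]
  [fintypeCrossing : Fintype Crossing]
  [decEqCrossing : DecidableEq Crossing]
  corner : Crossing → Fin 4 → Arc
  joint : Joint → Fin 2 → Arc
  two_ends : ∀ e : Arc,
    {p : (Crossing × Fin 4) ⊕ (Joint × Fin 2) |
      Sum.elim (fun q => corner q.1 q.2) (fun q => joint q.1 q.2) p = e}.ncard = 2

attribute [instance] LinkDiagram.finiteArc LinkDiagram.fintypeCrossing LinkDiagram.decEqCrossing

namespace LinkDiagram

/-- Two arcs are glued directly to each other in the state `s`, which chooses a smoothing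
(`true`: the `A`-smoothing, `false`: the `B`-smoothing) at every crossing.

Rotating the over-strand (corners `1`, `3`) counterclockwise sweeps out the region between the
corners `1`, `2` and the region between the corners `3`, `0`. The `A`-smoothing merges these two
regions, so it connects corner `0` to corner `1` and corner `2` to corner `3`. The `B`-smoothing
merges the other two regions. -/
inductive Glued (D : LinkDiagram) (s : D.Crossing → Bool) : D.Arc → D.Arc → Prop
  | joint (j : D.Joint) : Glued D s (D.joint j 0) (D.joint j 1)
  | smoothA₁ (c : D.Crossing) (h : s c = true) : Glued D s (D.corner c 0) (D.corner c 1)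
  | smoothA₂ (c : D.Crossing) (h : s c = true) : Glued D s (D.corner c 2) (D.corner c 3)
  | smoothB₁ (c : D.Crossing) (h : s c = false) : Glued D s (D.corner c 1) (D.corner c 2)
  | smoothB₂ (c : D.Crossing) (h : s c = false) : Glued D s (D.corner c 3) (D.corner c 0)

/-- The number of closed loops in the state `s`: the number of classes of arcs under the
equivalence relation generated by `Glued`. -/
def loops (D : LinkDiagram) (s : D.Crossing → Bool) : ℕ :=
  Nat.card (Quot (D.Glued s))

end LinkDiagram

/-- The power `A ^ m` (`m` an integer) of the variable `A` in `ℤ[A, A⁻¹]`. -/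
def Apow (m : ℤ) : ℤ[T;T⁻¹] := LaurentPolynomial.T m

/-- The loop value `d = -A² - A⁻²`. -/
def dLoop : ℤ[T;T⁻¹] := -Apow 2 - Apow (-2)

/-- The Kauffman bracket of a link diagram, with value `1` on a circle without crossings:
`⟨D⟩ = ∑ₛ A ^ (number of A-smoothings - number of B-smoothings) * d ^ (number of loops - 1)`,
the sum being over all states `s`. -/
def LinkDiagram.kauffmanBracket (D : LinkDiagram) : ℤ[T;T⁻¹] :=
  ∑ s : D.Crossing → Bool,
    (∏ c : D.Crossing, if s c = true then Apow 1 else Apow (-1)) * dLoop ^ (D.loops s - 1)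

/-! ### 4-plats and the standard diagram of `[0, a₁, …, aₙ]` -/

/-- A half-turn twist of two adjacent strands in a horizontal 4-strand diagram, whose strands
are numbered `0, 1, 2, 3` from top to bottom. If `middle` holds the strands `1`, `2` are twisted,
otherwise the strands `0`, `1`. If `positive` holds (positive twist sign) the over-strand of the
crossing goes from the lower left to the upper right, otherwise from the upper left to the lower
right. -/
structure Twist where
  middle : Bool
  positive : Bool

namespace FourPlat

/-- The upper one of the two strands that are twisted. -/
def upper (x : Twist) : Fin 4 := if x.middle then 1 else 0

/-- The lower one of the two strands that are twisted. -/
def lower (x : Twist) : Fin 4 := if x.middle then 2 else 1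

/-- The two strands that are not twisted. -/
def pass (x : Twist) : Bool → Fin 4
  | false => if x.middle then 0 else 2
  | true => 3

/-- In a 4-plat with twists `w = [w₀, …, w_(L-1)]`, from left to right, the arc `(t, i)` is the
part of strand `i` between the twists `w_(t-1)` and `w_t`. -/
abbrev Arc (w : List Twist) : Type := Fin (w.length + 1) × Fin 4

/-- The corners of the crossing number `t`, counterclockwise from an end of the under-strand:
north-west, south-west, south-east, north-east for a positive twist and south-west, south-east,
north-east, north-west for a negative one. -/
def corner (w : List Twist) (t : Fin w.length) : Fin 4 → Arc w :=
  if (w.get t).positive then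
    ![(t.castSucc, upper (w.get t)), (t.castSucc, lower (w.get t)),
      (t.succ, lower (w.get t)), (t.succ, upper (w.get t))]
  else
    ![(t.castSucc, lower (w.get t)), (t.succ, lower (w.get t)),
      (t.succ, upper (w.get t)), (t.castSucc, upper (w.get t))]

/-- The places where arcs meet without a crossing: the two strands passing by each twist, and the
two turns of the closing at either end. -/
inductive Joint (w : List Twist) : Type
  | pass (t : Fin w.length) (b : Bool)
  | left (b : Bool)
  | right (b : Bool)

/-- The arcs meeting at a joint. On the left, strand `0` is connected to strand `1` and strand `2`
to strand `3`. On the right the same holds if `odd` is true; otherwise strand `0` is connected to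
strand `3` and strand `1` to strand `2`. -/
def joint (w : List Twist) (odd : Bool) : Joint w → Fin 2 → Arc w
  | .pass t b => ![(t.castSucc, pass (w.get t) b), (t.succ, pass (w.get t) b)]
  | .left false => ![(0, 0), (0, 1)]
  | .left true => ![(0, 2), (0, 3)]
  | .right false => ![(Fin.last _, 0), (Fin.last _, if odd then 1 else 3)]
  | .right true => ![(Fin.last _, 2), (Fin.last _, if odd then 3 else 1)]

/-- The corners of the crossings together with the sides of the joints. -/
abbrev End (w : List Twist) : Type := (Fin w.length × Fin 4) ⊕ (Joint w × Fin 2)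

/-- The arc at a given corner of a crossing or side of a joint. -/
def endArc (w : List Twist) (odd : Bool) : End w → Arc w :=
  Sum.elim (fun q => corner w q.1 q.2) (fun q => joint w odd q.1 q.2)

end FourPlat

namespace FourPlat

/-- The ends at one twist, seen locally: `true` stands for the arc to the right of the twist. -/
def localEnd (x : Twist) : Fin 4 ⊕ (Bool × Fin 2) → Bool × Fin 4
  | .inl k =>
    if x.positive then ![(false, upper x), (false, lower x), (true, lower x), (true, upper x)] k
    else ![(false, lower x), (true, lower x), (true, upper x), (false, upper x)] k
  | .inr (b, k) => ![(false, pass x b), (true, pass x b)] k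

/-- Whether an end is the left end of its arc. -/
def isLeftEnd (w : List Twist) : End w → Bool
  | .inl (t, k) => (localEnd (w.get t) (.inl k)).1
  | .inr (.pass t b, k) => (localEnd (w.get t) (.inr (b, k))).1
  | .inr (.left _, _) => true
  | .inr (.right _, _) => false

theorem localEnd_unique (x : Twist) (b : Bool) (i : Fin 4) :
    ∃ q, ∀ q', localEnd x q' = (b, i) ↔ q' = q := by
  obtain ⟨m, p⟩ := x
  revert m p b i
  decide

theorem endArc_crossing (w : List Twist) (odd : Bool) (t : Fin w.length) (k : Fin 4) :
    endArc w odd (.inl (t, k)) =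
      (if (localEnd (w.get t) (.inl k)).1 then t.succ else t.castSucc,
        (localEnd (w.get t) (.inl k)).2) := by
  simp only [endArc, corner, localEnd, Sum.elim_inl]
  split_ifs <;> fin_cases k <;> simp_all

theorem endArc_pass (w : List Twist) (odd : Bool) (t : Fin w.length) (b : Bool) (k : Fin 2) :
    endArc w odd (.inr (.pass t b, k)) =
      (if (localEnd (w.get t) (.inr (b, k))).1 then t.succ else t.castSucc,
        (localEnd (w.get t) (.inr (b, k))).2) := by
  simp only [endArc, joint, localEnd, Sum.elim_inr]
  fin_cases k <;> simp

theorem twist_unique (w : List Twist) (odd : Bool) (t : Fin w.length) (b : Bool) (i : Fin 4) :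
    ∃ l : End w, ∀ p, (endArc w odd p = (if b then t.succ else t.castSucc, i) ∧
      isLeftEnd w p = b) ↔ p = l := by
  obtain ⟨q, hq⟩ := localEnd_unique (w.get t) b i
  refine ⟨Sum.map (fun k => (t, k)) (fun z => (Joint.pass t z.1, z.2)) q, fun p => ?_⟩
  have key : ∀ (t' : Fin w.length) (q' : Fin 4 ⊕ (Bool × Fin 2)),
      (((if (localEnd (w.get t') q').1 then t'.succ else t'.castSucc,
        (localEnd (w.get t') q').2) : Arc w) = (if b then t.succ else t.castSucc, i) ∧
        (localEnd (w.get t') q').1 = b) ↔ t' = t ∧ q' = q := by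
    intro t' q'
    constructor
    · rintro ⟨h1, h2⟩
      rw [Prod.mk.injEq, h2] at h1
      have ht : t' = t := by
        cases b <;> simpa using h1.1
      subst ht
      exact ⟨rfl, (hq q').1 (Prod.ext h2 h1.2)⟩
    · rintro ⟨rfl, rfl⟩
      rw [(hq q').2 rfl]
      exact ⟨rfl, rfl⟩
  rcases p with ⟨t', k⟩ | ⟨_ | _ | _, k⟩
  · rw [endArc_crossing]
    refine (key t' (.inl k)).trans ?_
    rcases q with q | q <;> simp
  · rw [endArc_pass]
    refine (key _ (.inr (_, k))).trans ?_
    rcases q with q | ⟨q, q'⟩ <;> simp [and_assoc]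
  all_goals
    rename_i b'
    cases b <;> rcases q with q | ⟨q, q'⟩ <;> cases b' <;> fin_cases k <;>
      simp [endArc, joint, isLeftEnd, Prod.ext_iff, Fin.ext_iff] <;> try omega

theorem left_unique (w : List Twist) (odd : Bool) (i : Fin 4) :
    ∃ l : End w, ∀ p, (endArc w odd p = (0, i) ∧ isLeftEnd w p = true) ↔ p = l := by
  refine ⟨.inr (.left (decide (2 ≤ i)), if i = 0 ∨ i = 2 then 0 else 1), fun p => ?_⟩
  rcases p with ⟨t', k⟩ | ⟨_ | b | b, k⟩
  · rw [endArc_crossing]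
    simp only [isLeftEnd]
    cases h : (localEnd (w.get t') (.inl k)).1 <;> simp
  · rw [endArc_pass]
    rename_i t' b
    simp only [isLeftEnd]
    cases h : (localEnd (w.get t') (.inr (b, k))).1 <;> simp
  · cases b <;> fin_cases k <;> fin_cases i <;> simp [endArc, joint, isLeftEnd]
  · simp [isLeftEnd]

theorem right_unique (w : List Twist) (odd : Bool) (i : Fin 4) :
    ∃ l : End w, ∀ p, (endArc w odd p = (Fin.last _, i) ∧ isLeftEnd w p = false) ↔ p = l := by
  refine ⟨.inr (.right (decide (i = 2 ∨ i = if odd then 3 else 1)),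
    if i = 0 ∨ i = 2 then 0 else 1), fun p => ?_⟩
  rcases p with ⟨t', k⟩ | ⟨_ | b | b, k⟩
  · rw [endArc_crossing]
    simp only [isLeftEnd]
    cases h : (localEnd (w.get t') (.inl k)).1 <;> simp [Fin.castSucc_ne_last]
  · rw [endArc_pass]
    rename_i t' b
    simp only [isLeftEnd]
    cases h : (localEnd (w.get t') (.inr (b, k))).1 <;> simp [Fin.castSucc_ne_last]
  · simp [isLeftEnd]
  · cases odd <;> cases b <;> fin_cases k <;> fin_cases i <;> simp [endArc, joint, isLeftEnd]

theorem two_ends (w : List Twist) (odd : Bool) (e : Arc w) :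
    {p : End w | endArc w odd p = e}.ncard = 2 := by
  obtain ⟨s, i⟩ := e
  have hl : ∃ l : End w, ∀ p, (endArc w odd p = (s, i) ∧ isLeftEnd w p = true) ↔ p = l := by
    induction s using Fin.cases with
    | zero => exact left_unique w odd i
    | succ t => simpa using twist_unique w odd t true i
  have hr : ∃ r : End w, ∀ p, (endArc w odd p = (s, i) ∧ isLeftEnd w p = false) ↔ p = r := by
    induction s using Fin.lastCases with
    | last => exact right_unique w odd i
    | cast t => simpa using twist_unique w odd t false i
  obtain ⟨l, hl⟩ := hl
  obtain ⟨r, hr⟩ := hr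
  rw [Set.ncard_eq_two]
  refine ⟨l, r, ?_, ?_⟩
  · rintro rfl
    have h1 := ((hl l).2 rfl).2
    have h2 := ((hr l).2 rfl).2
    simp [h1] at h2
  · ext p
    simp only [Set.mem_ofPred_eq, Set.mem_insert_iff, Set.mem_singleton_iff, ← hl, ← hr]
    cases isLeftEnd w p <;> simp

end FourPlat

/-- The 4-plat with the given twists, closed on the left by connecting strands `0`, `1` and
strands `2`, `3`, and on the right as prescribed by `odd`. -/
def fourPlat (w : List Twist) (odd : Bool) : LinkDiagram where
  Arc := FourPlat.Arc w
  Crossing := Fin w.length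
  Joint := FourPlat.Joint w
  corner := FourPlat.corner w
  joint := FourPlat.joint w odd
  two_ends := FourPlat.two_ends w odd

/-- The twist box number `k ≥ 1` of `[0, a₁, …, aₙ]`: `|a_k|` half-turns of the middle two strands
if `k` is odd, of the top two strands if `k` is even, all with twist sign
`(-1)^(k-1) * sign(a_k)`. -/
def twistBox (k : ℕ) (ak : ℤ) : List Twist :=
  List.replicate ak.natAbs
    { middle := decide (Odd k)
      positive := decide (0 < (-1 : ℤ) ^ (k + 1) * ak.sign) }

/-- The standard diagram of the unoriented rational link encoded by the continued fraction
`[0, a 1, …, a n]`. Its closing on the right depends on the parity of `n`. -/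
def standardDiagram (n : ℕ) (a : ℕ → ℤ) : LinkDiagram :=
  fourPlat ((List.range n).flatMap fun i => twistBox (i + 1) (a (i + 1))) (decide (Odd n))

/-! ### Tilings -/

/-- The tilings of a strip of `n` unit cells by tiles of lengths `1` and `2`: the compositions
of `n` all of whose parts are `1` or `2`. -/
def tilings (n : ℕ) : Finset (Composition n) :=
  {c : Composition n | ∀ i : Fin c.length, c.blocksFun i = 1 ∨ c.blocksFun i = 2}

/-- The weight of a tiling: the product of the weights of its tiles, where a tile of length `1`
covering the cell `k` weighs `single k`, and a tile of length `2` covering the cells `k`, `k + 1`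
weighs `domino k`. The cells are numbered from `1`; the tile number `i` starts right after the
first `c.sizeUpTo i` cells. -/
def tilingWeight {R : Type*} [CommRing R] (single domino : ℕ → R) {n : ℕ} (c : Composition n) : R :=
  ∏ i : Fin c.length,
    if c.blocksFun i = 1 then single (c.sizeUpTo i + 1) else domino (c.sizeUpTo i + 1)

/-- The `q`-integer `[m]_q = 1 + q + ⋯ + q^(m-1)`. -/
def qInt {R : Type*} [CommRing R] (m : ℕ) (q : R) : R := ∑ i ∈ Finset.range m, q ^ i

/-- The weight of a `1 × 1` tile on cell `k`, with `ε_k = sign (a k)`: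
`A^((-1)^(k-1) (2 ε_k - a_k)) [|a_k|]_q` with `q = -A^((-1)^(k-1) 4 ε_k)`,
plus the additional term `A^(-a₁) d` on the first cell. -/
def singleWeight (a : ℕ → ℤ) (k : ℕ) : ℤ[T;T⁻¹] :=
  if k = 1 then
    Apow (-a 1 + 2 * (a 1).sign) * qInt (a 1).natAbs (-Apow (4 * (a 1).sign))
      + Apow (-a 1) * dLoop
  else
    Apow ((-1) ^ (k - 1) * (2 * (a k).sign - a k)) *
      qInt (a k).natAbs (-Apow ((-1) ^ (k - 1) * (4 * (a k).sign)))

/-- The weight of a `2 × 1` tile on the cells `k`, `k + 1`: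
`(-1)^(a_k) A^((-1)^(k+1) (3 a_k + a_(k+1)))`. -/
def dominoWeight (a : ℕ → ℤ) (k : ℕ) : ℤ[T;T⁻¹] :=
  (((a k).negOnePow : ℤ) : ℤ[T;T⁻¹]) * Apow ((-1) ^ (k + 1) * (3 * a k + a (k + 1)))

end

/-! Smoothing a crossing of a 4-plat leaves a column that is either the identity or a cup-cap pair.
Only two closings, 01|23 and 03|12, can therefore occur to the left of any column. Absorbing an
identity column changes nothing. Absorbing a cup-cap pair replaces the closing by the one that
contains its cap, and splits off a loop exactly when the closing was already that one. Hence the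
bracket is linear in the left closing, and each crossing acts by a 2 × 2 matrix on the coefficients
of the two closings (`loops_fourPlat`, `matchingBracket_cons`, `formalBracket_cons`).

A box of m crossings with twist sign e sends the closing other than its own to α times itself plus h
times its own, where α = A^(-em) and h = `hookWeight e m`. It multiplies its own closing by κ = α +
d h = (-1)^m A^(3em), the value of m kinks (`foldl_twistStep_replicate`,
`Apow_add_dLoop_mul_hookWeight`).

Now expand the last box of the diagram with n + 2 boxes. Its cup-cap part, of weight h, leaves the
diagram with n + 1 boxes, correctly closed. Its identity part, of weight α, leaves a closing that
turns box n + 1 into kinks, which gives κ of that box times the bracket with n boxes. So K_(n+2) =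
h_(n+2) K_(n+1) + κ_(n+1) α_(n+2) K_n. Removing the last tile gives the same recursion for tilings,
and the initial values agree. -/

noncomputable section

/-! ### Counting the classes of a relation -/

/-- If `f` and `g` induce mutually inverse maps between `Quot R` and `Y`, the two types have the
same cardinality. -/
theorem card_quot_eq_of_inverse {X Y : Type*} {R : X → X → Prop} (f : X → Y) (g : Y → Quot R)
    (hf : ∀ a b, R a b → f a = f b) (hfg : ∀ y, Quot.lift f hf (g y) = y)
    (hgf : ∀ x, g (f x) = Quot.mk R x) : Nat.card (Quot R) = Nat.card Y :=
  Nat.card_congr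
    { toFun := Quot.lift f hf
      invFun := g
      left_inv := fun q => by
        induction q using Quot.ind with
        | mk x => exact hgf x
      right_inv := hfg }

/-- Two relations, each of which is contained in the equivalence relation generated by the other,
have equally many classes. -/
theorem card_quot_congr {X : Type*} {R S : X → X → Prop}
    (h₁ : ∀ a b, R a b → Quot.mk S a = Quot.mk S b)
    (h₂ : ∀ a b, S a b → Quot.mk R a = Quot.mk R b) : Nat.card (Quot R) = Nat.card (Quot S) :=
  card_quot_eq_of_inverse (Quot.mk S) (Quot.lift (Quot.mk R) h₂) h₁
    (fun y => by induction y using Quot.ind with | mk x => rfl) (fun _ => rfl)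

/-! ### Loops of crossingless 4-plats -/

namespace FourPlat

/-- The two crossingless matchings of four strands: `false` connects `0`, `1` and `2`, `3`, while
`true` connects `0`, `3` and `1`, `2`. -/
def partner : Bool → Fin 4 → Fin 4
  | false => ![1, 0, 3, 2]
  | true => ![3, 2, 1, 0]

/-- The upper strand of the cup-cap pair at the middle (`true`) or top (`false`) position. -/
def hookUpper (b : Bool) : Fin 4 := if b then 1 else 0

/-- The lower strand of the cup-cap pair at the middle (`true`) or top (`false`) position. -/
def hookLower (b : Bool) : Fin 4 := if b then 2 else 1

/-- The gluing of arcs in a crossingless 4-plat with `L` columns. The column `t` is the identity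
if `o t = none` and a cup-cap pair at the position `b` if `o t = some b`. The plat is closed by
the matching `m` on the left and by the matching `r` on the right. -/
inductive Smoothed {L : ℕ} (o : Fin L → Option Bool) (m r : Bool) :
    Fin (L + 1) × Fin 4 → Fin (L + 1) × Fin 4 → Prop
  | left (i : Fin 4) : Smoothed o m r (0, i) (0, partner m i)
  | right (i : Fin 4) : Smoothed o m r (Fin.last L, i) (Fin.last L, partner r i)
  | through (t : Fin L) (i : Fin 4) (h : ∀ b, o t = some b → i ≠ hookUpper b ∧ i ≠ hookLower b) :
      Smoothed o m r (t.castSucc, i) (t.succ, i)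
  | cup (t : Fin L) (b : Bool) (h : o t = some b) :
      Smoothed o m r (t.castSucc, hookUpper b) (t.castSucc, hookLower b)
  | cap (t : Fin L) (b : Bool) (h : o t = some b) :
      Smoothed o m r (t.succ, hookUpper b) (t.succ, hookLower b)

/-- The number of loops of a crossingless 4-plat. -/
def smoothedLoops {L : ℕ} (o : Fin L → Option Bool) (m r : Bool) : ℕ :=
  Nat.card (Quot (Smoothed o m r))

theorem smoothedLoops_pos {L : ℕ} (o : Fin L → Option Bool) (m r : Bool) :
    0 < smoothedLoops o m r :=
  have : Nonempty (Quot (Smoothed o m r)) := ⟨Quot.mk _ (0, 0)⟩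
  Nat.card_pos

/-- If the arcs of a 4-plat with one column removed are glued on the left by `m'`, and this gluing
is induced by the larger plat, then the whole gluing is. -/
theorem Smoothed.shift {L : ℕ} {o : Fin L → Option Bool} {x : Option Bool} {m m' r : Bool}
    (hleft : ∀ i, Quot.mk (Smoothed (Fin.cons x o : Fin (L + 1) → Option Bool) m r) (1, i) =
      Quot.mk _ (1, partner m' i))
    {p q : Fin (L + 1) × Fin 4} (h : Smoothed o m' r p q) :
    Quot.mk (Smoothed (Fin.cons x o : Fin (L + 1) → Option Bool) m r) (p.1.succ, p.2) =
      Quot.mk _ (q.1.succ, q.2) := by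
  cases h with
  | left i => exact hleft i
  | right i => exact Quot.sound (.right i)
  | through t i h => exact Quot.sound (.through t.succ i (by simpa using h))
  | cup t b h => exact Quot.sound (.cup t.succ b (by simpa using h))
  | cap t b h => exact Quot.sound (.cap t.succ b (by simpa using h))

theorem smoothedLoops_cons_none {L : ℕ} (o : Fin L → Option Bool) (m r : Bool) :
    smoothedLoops (Fin.cons none o : Fin (L + 1) → Option Bool) m r = smoothedLoops o m r := by
  have hthrough : ∀ i, Quot.mk (Smoothed (Fin.cons none o : Fin (L + 1) → Option Bool) m r) (0, i)
      = Quot.mk _ (1, i) := fun i => Quot.sound (.through 0 i (by simp))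
  refine card_quot_eq_of_inverse
    (fun p => Quot.mk _ (Fin.cases 0 id p.1, p.2))
    (Quot.lift (fun p => Quot.mk _ (p.1.succ, p.2)) fun p q => Smoothed.shift fun i => ?_)
    ?_ ?_ ?_
  · rw [← hthrough, ← hthrough]
    exact Quot.sound (.left i)
  · intro p q h
    cases h with
    | left i => exact Quot.sound (.left i)
    | right i => exact Quot.sound (.right i)
    | through t i h =>
      cases t using Fin.cases with
      | zero => rfl
      | succ t => exact Quot.sound (.through t i (by simpa using h))
    | cup t b h =>
      cases t using Fin.cases with
      | zero => simp at h
      | succ t => exact Quot.sound (.cup t b (by simpa using h))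
    | cap t b h =>
      cases t using Fin.cases with
      | zero => simp at h
      | succ t => exact Quot.sound (.cap t b (by simpa using h))
  · intro y
    induction y using Quot.ind with
    | mk p => rfl
  · rintro ⟨t, i⟩
    cases t using Fin.cases with
    | zero => exact (hthrough i).symm
    | succ t => rfl

theorem hookLower_eq_partner (b : Bool) : hookLower b = partner b (hookUpper b) := by
  cases b <;> rfl

/-- Every gluing on the right of a cup-cap pair is that of the matching at its position. -/
theorem mk_partner_of_cons_some {L : ℕ} (o : Fin L → Option Bool) (b m r : Bool) (i : Fin 4) :
    Quot.mk (Smoothed (Fin.cons (some b) o : Fin (L + 1) → Option Bool) m r) (1, i) =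
      Quot.mk _ (1, partner b i) := by
  have hcap := Quot.sound (Smoothed.cap (o := (Fin.cons (some b) o : Fin (L + 1) → Option Bool))
    (m := m) (r := r) 0 b rfl)
  have hcup := Quot.sound (Smoothed.cup (o := (Fin.cons (some b) o : Fin (L + 1) → Option Bool))
    (m := m) (r := r) 0 b rfl)
  have hth : ∀ j, j ≠ hookUpper b → j ≠ hookLower b →
      Quot.mk (Smoothed (Fin.cons (some b) o : Fin (L + 1) → Option Bool) m r) (0, j) =
        Quot.mk _ (1, j) :=
    fun j h h' => Quot.sound (.through 0 j (by simp [h, h']))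
  have hl := fun j => Quot.sound
    (Smoothed.left (o := (Fin.cons (some b) o : Fin (L + 1) → Option Bool)) (m := m) (r := r) j)
  have h0 := hl 0
  have h1 := hl 1
  have h2 := hl 2
  have h3 := hl 3
  -- Strand `1` is missing because it belongs to the cup-cap pair at either position.
  have t0 := hth 0
  have t2 := hth 2
  have t3 := hth 3
  cases b <;> cases m <;> fin_cases i <;>
    simp [hookUpper, hookLower, partner] at * <;> grind

/-- All left arcs outside of a loop at the leftmost cup-cap pair are glued to strand `3`. -/
theorem mk_zero_of_cons_some {L : ℕ} (o : Fin L → Option Bool) (b m r : Bool) (i : Fin 4)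
    (hi : m = b → i ≠ hookUpper b ∧ i ≠ hookLower b) :
    Quot.mk (Smoothed (Fin.cons (some b) o : Fin (L + 1) → Option Bool) m r) (0, i) =
      Quot.mk _ (1, 3) := by
  have hcup := Quot.sound (Smoothed.cup (o := (Fin.cons (some b) o : Fin (L + 1) → Option Bool))
    (m := m) (r := r) 0 b rfl)
  have hth : Quot.mk (Smoothed (Fin.cons (some b) o : Fin (L + 1) → Option Bool) m r) (0, 3) =
        Quot.mk _ (1, 3) :=
    Quot.sound (.through 0 3 (by cases b <;> simp [hookUpper, hookLower]))
  have hl := fun j => Quot.sound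
    (Smoothed.left (o := (Fin.cons (some b) o : Fin (L + 1) → Option Bool)) (m := m) (r := r) j)
  have h0 := hl 0
  have h1 := hl 1
  have h2 := hl 2
  cases b <;> cases m <;> fin_cases i <;>
    simp [hookUpper, hookLower, partner] at * <;> grind

/-- The closing and the cup together join all four left arcs into one path, which continues to the
right along strand `3`; no loop is split off. -/
theorem smoothedLoops_cons_some_of_ne {L : ℕ} (o : Fin L → Option Bool) {b m : Bool} (r : Bool)
    (hm : m ≠ b) :
    smoothedLoops (Fin.cons (some b) o : Fin (L + 1) → Option Bool) m r =
      smoothedLoops o b r := by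
  -- Strand `3` is never in a cup-cap pair, so its arc in the shortened plat can represent
  -- everything to the left of the removed column.
  refine card_quot_eq_of_inverse
    (fun p => Fin.cases (motive := fun _ => Quot (Smoothed o b r)) (Quot.mk _ (0, 3))
      (fun t => Quot.mk _ (t, p.2)) p.1)
    (Quot.lift (fun p => Quot.mk _ (p.1.succ, p.2)) fun p q =>
      Smoothed.shift (mk_partner_of_cons_some o b m r)) ?_ ?_ ?_
  · intro p q h
    cases h with
    | left i => rfl
    | right i => exact Quot.sound (.right i)
    | through t i h =>
      cases t using Fin.cases with
      | zero =>
        have h := h b rfl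
        have hl := Quot.sound (Smoothed.left (o := o) (m := b) (r := r) 3)
        show Quot.mk _ (0, 3) = Quot.mk _ (0, i)
        cases b <;> fin_cases i <;> simp_all [hookUpper, hookLower, partner]
      | succ t => exact Quot.sound (.through t i (by simpa using h))
    | cup t b' h =>
      cases t using Fin.cases with
      | zero => rfl
      | succ t => exact Quot.sound (.cup t b' (by simpa using h))
    | cap t b' h =>
      cases t using Fin.cases with
      | zero =>
        obtain rfl : b = b' := by simpa using h
        rw [hookLower_eq_partner]
        exact Quot.sound (.left _)
      | succ t => exact Quot.sound (.cap t b' (by simpa using h))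
  · intro y
    induction y using Quot.ind with
    | mk p => rfl
  · rintro ⟨t, i⟩
    cases t using Fin.cases with
    | zero => exact (mk_zero_of_cons_some o b m r i fun h => absurd h hm).symm
    | succ t => rfl

/-- The cup meets an arc of the closing with the same two ends and bounds a loop with it. This loop
is the `none` added to the classes of the shortened plat. -/
theorem smoothedLoops_cons_some_self {L : ℕ} (o : Fin L → Option Bool) (b r : Bool) :
    smoothedLoops (Fin.cons (some b) o : Fin (L + 1) → Option Bool) b r =
      smoothedLoops o b r + 1 := by
  have hcard : smoothedLoops o b r + 1 = Nat.card (Option (Quot (Smoothed o b r))) :=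
    Finite.card_option.symm
  rw [hcard]
  refine card_quot_eq_of_inverse
    (fun p => Fin.cases (motive := fun _ => Option (Quot (Smoothed o b r)))
      (if p.2 = hookUpper b ∨ p.2 = hookLower b then none else some (Quot.mk _ (0, 3)))
      (fun t => some (Quot.mk _ (t, p.2))) p.1)
    (fun y => y.elim (Quot.mk _ (0, hookUpper b))
      (Quot.lift (fun p => Quot.mk _ (p.1.succ, p.2)) fun p q =>
        Smoothed.shift (mk_partner_of_cons_some o b b r))) ?_ ?_ ?_
  · intro p q h
    cases h with
    | left i => cases b <;> fin_cases i <;> simp [hookUpper, hookLower, partner]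
    | right i => exact congrArg some (Quot.sound (.right i))
    | through t i h =>
      cases t using Fin.cases with
      | zero =>
        have h := h b rfl
        have hl := Quot.sound (Smoothed.left (o := o) (m := b) (r := r) 3)
        show (if i = hookUpper b ∨ i = hookLower b then none else some (Quot.mk _ (0, 3))) =
          some (Quot.mk _ (0, i))
        cases b <;> fin_cases i <;> simp_all [hookUpper, hookLower, partner]
      | succ t => exact congrArg some (Quot.sound (.through t i (by simpa using h)))
    | cup t b' h =>
      cases t using Fin.cases with
      | zero =>
        obtain rfl : b = b' := by simpa using h
        simp
      | succ t => exact congrArg some (Quot.sound (.cup t b' (by simpa using h)))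
    | cap t b' h =>
      cases t using Fin.cases with
      | zero =>
        obtain rfl : b = b' := by simpa using h
        rw [hookLower_eq_partner]
        exact congrArg some (Quot.sound (.left _))
      | succ t => exact congrArg some (Quot.sound (.cap t b' (by simpa using h)))
  · rintro (_ | y)
    · simp
    · induction y using Quot.ind with
      | mk p => rfl
  · rintro ⟨t, i⟩
    cases t using Fin.cases with
    | zero =>
      by_cases hi : i = hookUpper b ∨ i = hookLower b
      · simp only [Fin.cases_zero, hi, if_true, Option.elim_none]
        rcases hi with rfl | rfl
        · rfl
        · exact Quot.sound (.cup 0 b rfl)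
      · simp only [Fin.cases_zero, hi, if_false, Option.elim_some]
        exact (mk_zero_of_cons_some o b b r i fun _ => by simpa using hi).symm
    | succ t => rfl

theorem smoothedLoops_nil (o : Fin 0 → Option Bool) (m r : Bool) :
    smoothedLoops o m r = if m = r then 2 else 1 := by
  have hl := fun j => Quot.sound (Smoothed.left (o := o) (m := m) (r := r) j)
  have hr := fun j => Quot.sound (Smoothed.right (o := o) (m := m) (r := r) j)
  split_ifs with h
  · subst h
    -- `Bool` models the two loops: `true` is the loop through strand `0`, `false` the loop through
    -- strand `2`.
    rw [← Nat.card_eq_two_iff.2 ⟨false, true, by simp, by ext x; cases x <;> simp⟩]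
    refine card_quot_eq_of_inverse
      (fun p => decide (p.2 = 0 ∨ p.2 = partner m 0))
      (fun y => if y then Quot.mk _ (0, 0) else Quot.mk _ (0, 2)) ?_ ?_ ?_
    · intro p q h
      cases h with
      | left i => cases m <;> fin_cases i <;> simp [partner]
      | right i => cases m <;> fin_cases i <;> simp [partner]
      | through t => exact t.elim0
      | cup t => exact t.elim0
      | cap t => exact t.elim0
    · intro y
      cases m <;> cases y <;> simp [partner]
    · rintro ⟨t, i⟩
      obtain rfl : t = 0 := Fin.fin_one_eq_zero t
      have h0 := hl 0
      have h2 := hl 2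
      cases m <;> fin_cases i <;> simp [partner] at * <;> grind
  · rw [← Nat.card_unique (α := Unit)]
    refine card_quot_eq_of_inverse (fun _ => ()) (fun _ => Quot.mk _ (0, 0))
      (fun _ _ _ => rfl) (fun _ => rfl) ?_
    rintro ⟨t, i⟩
    obtain rfl : t = 0 := Fin.fin_one_eq_zero t
    have h0 := hl 0
    have h2 := hl 2
    have k0 := hr 0
    have k1 := hr 1
    have k2 := hr 2
    -- Without columns both matchings act on the same four arcs.
    have e : Fin.last 0 = 0 := rfl
    rw [e] at k0 k1 k2
    cases m <;> cases r <;> fin_cases i <;> simp [partner] at * <;> grind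

/-! ### States of a 4-plat as crossingless plats -/

/-- The columns of the crossingless 4-plat obtained by smoothing all the crossings. -/
def columns (w : List Twist) (s : Fin w.length → Bool) (t : Fin w.length) : Option Bool :=
  if s t = (w.get t).positive then some (w.get t).middle else none

end FourPlat

open FourPlat

theorem FourPlat.exists_eq_pass (x : Twist) (i : Fin 4) (h : i ≠ upper x) (h' : i ≠ lower x) :
    ∃ b, i = FourPlat.pass x b := by
  obtain ⟨m, p⟩ := x
  revert m p i
  decide

/-- The `A`-smoothing of a positive twist joins north-west to south-west and is a cup-cap pair,
while for a negative twist the `B`-smoothing is. The two gluing relations thus generate the same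
equivalence, though they differ in the orientation and labelling of the gluings. -/
theorem loops_fourPlat (w : List Twist) (odd : Bool) (s : Fin w.length → Bool) :
    (fourPlat w odd).loops s = smoothedLoops (columns w s) false (!odd) := by
  refine card_quot_congr ?_ ?_
  · have hth : ∀ t : Fin w.length, s t ≠ (w.get t).positive → ∀ i,
        Quot.mk (Smoothed (columns w s) false (!odd)) (t.castSucc, i) = Quot.mk _ (t.succ, i) :=
      fun t ht i => Quot.sound (.through t i (fun b hb => by
        rw [columns, if_neg ht] at hb
        cases hb))
    have hcup : ∀ t : Fin w.length, s t = (w.get t).positive →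
        Quot.mk (Smoothed (columns w s) false (!odd)) (t.castSucc, upper (w.get t)) =
          Quot.mk _ (t.castSucc, lower (w.get t)) :=
      fun t ht => Quot.sound (.cup t (w.get t).middle (if_pos ht))
    have hcap : ∀ t : Fin w.length, s t = (w.get t).positive →
        Quot.mk (Smoothed (columns w s) false (!odd)) (t.succ, upper (w.get t)) =
          Quot.mk _ (t.succ, lower (w.get t)) :=
      fun t ht => Quot.sound (.cap t (w.get t).middle (if_pos ht))
    intro p q h
    cases h with
    | joint j =>
      rcases j with ⟨t, b⟩ | b | b
      · refine Quot.sound (.through t _ fun b' hb' => ?_)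
        simp only [columns] at hb'
        obtain rfl : (w.get t).middle = b' := by
          split_ifs at hb'
          simpa using hb'
        generalize w.get t = x
        obtain ⟨x, y⟩ := x
        cases b <;> cases x <;> simp [FourPlat.pass, hookUpper, hookLower]
      · cases b
        · exact Quot.sound (.left 0)
        · exact Quot.sound (.left 2)
      · cases b <;> cases odd
        · exact Quot.sound (.right 0)
        · exact Quot.sound (.right 0)
        · exact Quot.sound (.right 2)
        · exact Quot.sound (.right 2)
    -- All four smoothing rules at once: each is a strand running through, a cup or a cap, possibly
    -- reversed.
    | _ c h =>
      change Fin w.length at c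
      change s c = _ at h
      specialize hth c
      specialize hcup c
      specialize hcap c
      rw [h] at hth hcup hcap
      cases hp : (w.get c).positive <;> rw [hp] at hth hcup hcap <;>
        simp only [ne_eq, reduceCtorEq, not_true, not_false_eq_true, IsEmpty.forall_iff,
          forall_const] at hth hcup hcap <;>
        simp only [fourPlat, FourPlat.corner, hp, if_true, if_false, Bool.false_eq_true,
          Matrix.cons_val] <;>
        first
        | exact hth _
        | exact (hth _).symm
        | exact hcup
        | exact hcup.symm
        | exact hcap
        | exact hcap.symm
  · have hA₁ : ∀ c : Fin w.length, s c = true → _ := fun c h =>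
      Quot.sound (LinkDiagram.Glued.smoothA₁ (D := fourPlat w odd) (s := s) c h)
    have hA₂ : ∀ c : Fin w.length, s c = true → _ := fun c h =>
      Quot.sound (LinkDiagram.Glued.smoothA₂ (D := fourPlat w odd) (s := s) c h)
    have hB₁ : ∀ c : Fin w.length, s c = false → _ := fun c h =>
      Quot.sound (LinkDiagram.Glued.smoothB₁ (D := fourPlat w odd) (s := s) c h)
    have hB₂ : ∀ c : Fin w.length, s c = false → _ := fun c h =>
      Quot.sound (LinkDiagram.Glued.smoothB₂ (D := fourPlat w odd) (s := s) c h)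
    have hcorner : (fourPlat w odd).corner = FourPlat.corner w := rfl
    have hcolumn : ∀ (t : Fin w.length) b, columns w s t = some b →
        s t = (w.get t).positive ∧ b = (w.get t).middle := by
      intro t b h
      simp only [columns] at h
      split_ifs at h with h'
      exact ⟨h', by simpa using h.symm⟩
    intro p q h
    cases h with
    | left i =>
      have h0 := Quot.sound (LinkDiagram.Glued.joint (D := fourPlat w odd) (s := s) (.left false))
      have h2 := Quot.sound (LinkDiagram.Glued.joint (D := fourPlat w odd) (s := s) (.left true))
      fin_cases i
      exacts [h0, h0.symm, h2, h2.symm]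
    | right i =>
      have h0 := Quot.sound (LinkDiagram.Glued.joint (D := fourPlat w odd) (s := s) (.right false))
      have h2 := Quot.sound (LinkDiagram.Glued.joint (D := fourPlat w odd) (s := s) (.right true))
      cases odd <;> fin_cases i
      exacts [h0, h2.symm, h2, h0.symm, h0, h0.symm, h2, h2.symm]
    | through t i h =>
      have hpass : i ≠ upper (w.get t) → i ≠ lower (w.get t) →
          Quot.mk ((fourPlat w odd).Glued s) (t.castSucc, i) = Quot.mk _ (t.succ, i) := by
        intro h h'
        obtain ⟨b, rfl⟩ : ∃ b, i = FourPlat.pass (w.get t) b := exists_eq_pass _ _ h h'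
        exact Quot.sound
          (LinkDiagram.Glued.joint (D := fourPlat w odd) (s := s) (Joint.pass t b))
      by_cases hs : s t = (w.get t).positive
      · have h' := h (w.get t).middle (by simp [columns, hs])
        exact hpass h'.1 h'.2
      · by_cases hu : i = upper (w.get t)
        · subst hu
          cases hst : s t <;> cases hp : (w.get t).positive <;> rw [hst, hp] at hs <;>
            try exact absurd rfl hs
          · have := hB₂ t hst
            rw [hcorner, FourPlat.corner, if_pos hp] at this
            exact this.symm
          · have := hA₂ t hst
            rw [hcorner, FourPlat.corner, if_neg (ne_true_of_eq_false hp)] at this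
            exact this.symm
        · by_cases hl : i = lower (w.get t)
          · subst hl
            cases hst : s t <;> cases hp : (w.get t).positive <;> rw [hst, hp] at hs <;>
            try exact absurd rfl hs
            · have := hB₁ t hst
              rw [hcorner, FourPlat.corner, if_pos hp] at this
              exact this
            · have := hA₁ t hst
              rw [hcorner, FourPlat.corner, if_neg (ne_true_of_eq_false hp)] at this
              exact this
          · exact hpass hu hl
    | cup t b h =>
      obtain ⟨hs, rfl⟩ := hcolumn t b h
      cases hp : (w.get t).positive
      · have := hB₂ t (hs.trans hp)
        rw [hcorner, FourPlat.corner, if_neg (ne_true_of_eq_false hp)] at this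
        exact this
      · have := hA₁ t (hs.trans hp)
        rw [hcorner, FourPlat.corner, if_pos hp] at this
        exact this
    | cap t b h =>
      obtain ⟨hs, rfl⟩ := hcolumn t b h
      cases hp : (w.get t).positive
      · have := hB₁ t (hs.trans hp)
        rw [hcorner, FourPlat.corner, if_neg (ne_true_of_eq_false hp)] at this
        exact this.symm
      · have := hA₂ t (hs.trans hp)
        rw [hcorner, FourPlat.corner, if_pos hp] at this
        exact this.symm

/-! ### The bracket as an action on the two left closings -/

theorem Apow_add (m n : ℤ) : Apow (m + n) = Apow m * Apow n := LaurentPolynomial.T_add m n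

theorem Apow_zero : Apow 0 = 1 := LaurentPolynomial.T_zero

theorem Apow_pow (m : ℤ) (n : ℕ) : Apow m ^ n = Apow (n * m) := LaurentPolynomial.T_pow m n

/-- The weight of a smoothing: `A` for the `A`-smoothing and `A⁻¹` for the `B`-smoothing. -/
def smoothingWeight (b : Bool) : ℤ[T;T⁻¹] := if b then Apow 1 else Apow (-1)

/-- The Kauffman bracket of the 4-plat with the twists `w`, closed by the matching `m` on the left
and by the matching `r` on the right. -/
def matchingBracket (w : List Twist) (m r : Bool) : ℤ[T;T⁻¹] :=
  ∑ s : Fin w.length → Bool,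
    (∏ t, smoothingWeight (s t)) * dLoop ^ (smoothedLoops (columns w s) m r - 1)

theorem kauffmanBracket_fourPlat (w : List Twist) (odd : Bool) :
    (fourPlat w odd).kauffmanBracket = matchingBracket w false (!odd) := by
  unfold LinkDiagram.kauffmanBracket matchingBracket
  exact Finset.sum_congr rfl fun s _ =>
    congrArg (fun l => (∏ t : Fin w.length, smoothingWeight (s t)) * dLoop ^ (l - 1))
      (loops_fourPlat w odd s)

theorem matchingBracket_nil (m r : Bool) :
    matchingBracket [] m r = if m = r then dLoop else 1 := by
  have h : ∀ s, smoothedLoops (columns [] s) m r = if m = r then 2 else 1 :=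
    fun s => smoothedLoops_nil _ m r
  simp only [matchingBracket, h]
  split_ifs <;> simp

theorem columns_cons (x : Twist) (w : List Twist) (b : Bool) (s : Fin w.length → Bool) :
    columns (x :: w) (Fin.cons b s : Fin (w.length + 1) → Bool) =
      (Fin.cons (if b = x.positive then some x.middle else none) (columns w s) :
        Fin (w.length + 1) → Option Bool) := by
  funext t
  cases t using Fin.cases <;> rfl

/-- Smoothing the leftmost crossing of a 4-plat. -/
theorem matchingBracket_cons (x : Twist) (w : List Twist) (m r : Bool) :
    matchingBracket (x :: w) m r =
      smoothingWeight (!x.positive) * matchingBracket w m r +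
        smoothingWeight x.positive *
          ((if m = x.middle then dLoop else 1) * matchingBracket w x.middle r) := by
  have hprod : ∀ (b : Bool) (s : Fin w.length → Bool),
      ∏ t : Fin (w.length + 1), smoothingWeight ((Fin.cons b s : Fin (w.length + 1) → Bool) t) =
        smoothingWeight b * ∏ t, smoothingWeight (s t) := fun b s => by
    simp only [Fin.prod_univ_succ, Fin.cons_zero, Fin.cons_succ]
  have hsplit : matchingBracket (x :: w) m r =
      ∑ b : Bool, ∑ s : Fin w.length → Bool, (smoothingWeight b * ∏ t, smoothingWeight (s t)) *
        dLoop ^ (smoothedLoops (Fin.cons (if b = x.positive then some x.middle else none)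
          (columns w s) : Fin (w.length + 1) → Option Bool) m r - 1) := by
    rw [← Fintype.sum_prod_type', matchingBracket]
    refine (Fintype.sum_equiv (Fin.consEquiv fun _ => Bool) _ _ fun p => ?_).symm
    rw [← columns_cons, ← hprod]
    rfl
  have hnone : ∀ s : Fin w.length → Bool,
      smoothedLoops (Fin.cons none (columns w s) : Fin (w.length + 1) → Option Bool) m r =
        smoothedLoops (columns w s) m r := fun s => smoothedLoops_cons_none _ m r
  have hsome : ∀ s : Fin w.length → Bool,
      dLoop ^ (smoothedLoops (Fin.cons (some x.middle) (columns w s) :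
        Fin (w.length + 1) → Option Bool) m r - 1) =
      (if m = x.middle then dLoop else 1) *
        dLoop ^ (smoothedLoops (columns w s) x.middle r - 1) := by
    intro s
    split_ifs with hm
    · subst hm
      rw [smoothedLoops_cons_some_self, ← pow_succ']
      -- Positivity is needed because the exponent of `dLoop` is a truncated difference.
      have := smoothedLoops_pos (columns w s) x.middle r
      congr 1
      omega
    · rw [smoothedLoops_cons_some_of_ne _ r hm, one_mul]
  have hsum : ∀ f : Bool → ℤ[T;T⁻¹], ∑ b, f b = f (!x.positive) + f x.positive := by
    intro f
    rw [Fintype.sum_bool]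
    cases x.positive
    · rfl
    · exact add_comm _ _
  rw [hsplit, hsum]
  simp only [Bool.not_eq_self, if_false, if_true, hnone, hsome, matchingBracket, Finset.mul_sum]
  congr 1
  all_goals exact Finset.sum_congr rfl fun s _ => by ring

/-- The bracket of a 4-plat whose left closing is the combination of the matchings `false` and
`true` with the coefficients `v`. -/
def formalBracket (w : List Twist) (v : ℤ[T;T⁻¹] × ℤ[T;T⁻¹]) (r : Bool) : ℤ[T;T⁻¹] :=
  v.1 * matchingBracket w false r + v.2 * matchingBracket w true r

/-- The effect of a twist on a combination of the two matchings to its left. -/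
def twistStep (v : ℤ[T;T⁻¹] × ℤ[T;T⁻¹]) (x : Twist) : ℤ[T;T⁻¹] × ℤ[T;T⁻¹] :=
  if x.middle then
    (smoothingWeight (!x.positive) * v.1,
      smoothingWeight x.positive * v.1 + -smoothingWeight x.positive ^ 3 * v.2)
  else
    (smoothingWeight x.positive * v.2 + -smoothingWeight x.positive ^ 3 * v.1,
      smoothingWeight (!x.positive) * v.2)

/-- The value of a kink, as in the first Reidemeister move: for the `A`-smoothing, A⁻¹ + A d = -A³.
-/
theorem smoothingWeight_not_add (b : Bool) :
    smoothingWeight (!b) + smoothingWeight b * dLoop = -smoothingWeight b ^ 3 := by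
  cases b <;>
    simp only [smoothingWeight, dLoop, Bool.not_true, Bool.not_false, if_true, if_false,
      Bool.false_eq_true, mul_sub, mul_neg, ← Apow_add, Apow_pow] <;>
    norm_num
  ring

theorem formalBracket_cons (x : Twist) (w : List Twist) (v : ℤ[T;T⁻¹] × ℤ[T;T⁻¹]) (r : Bool) :
    formalBracket (x :: w) v r = formalBracket w (twistStep v x) r := by
  have h := smoothingWeight_not_add x.positive
  simp only [formalBracket, twistStep, matchingBracket_cons]
  cases x.middle <;>
    simp only [if_true, if_false, Bool.false_eq_true, reduceCtorEq, one_mul, ← h] <;> ring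

theorem formalBracket_eq_foldl (w : List Twist) (v : ℤ[T;T⁻¹] × ℤ[T;T⁻¹]) (r : Bool) :
    formalBracket w v r = formalBracket [] (w.foldl twistStep v) r := by
  induction w generalizing v with
  | nil => rfl
  | cons x w ih => rw [formalBracket_cons, ih, List.foldl_cons]

theorem formalBracket_nil (v : ℤ[T;T⁻¹] × ℤ[T;T⁻¹]) (r : Bool) :
    formalBracket [] v r = if r then v.1 + dLoop * v.2 else dLoop * v.1 + v.2 := by
  cases r <;> simp [formalBracket, matchingBracket_nil, mul_comm]

/-! ### Closed form for a twist box -/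

/-- The weight of a box of `m` half-turns with twist sign `e`, when it is replaced by a single
cup-cap pair. -/
def hookWeight (e : ℤ) (m : ℕ) : ℤ[T;T⁻¹] :=
  Apow (e * (2 - m)) * qInt m (-Apow (4 * e))

theorem neg_Apow_pow (e : ℤ) (m : ℕ) : (-Apow e) ^ m = (-1) ^ m * Apow (m * e) := by
  rw [neg_pow, Apow_pow]

/-- For a crossing added on the right, either all earlier columns are identities and the new one is
the first cup-cap pair, or a pair is already present and the new crossing is a kink on it. -/
theorem hookWeight_succ (e : ℤ) (m : ℕ) :
    hookWeight e (m + 1) = Apow e * Apow (-e * m) + (-Apow (3 * e)) * hookWeight e m := by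
  have hq : qInt (m + 1) (-Apow (4 * e)) = 1 + -Apow (4 * e) * qInt m (-Apow (4 * e)) := by
    simp only [qInt, Finset.sum_range_succ', Finset.mul_sum, pow_succ', pow_zero]
    exact add_comm _ _
  rw [hookWeight, hookWeight, hq, mul_add, mul_one]
  congr 1
  · rw [← Apow_add]
    congr 1
    push_cast
    ring
  · rw [← mul_assoc, ← mul_assoc, mul_neg, neg_mul (Apow (3 * e)), ← Apow_add, ← Apow_add]
    congr 3
    push_cast
    ring

theorem foldl_twistStep_replicate (x : Twist) (m : ℕ) (v : ℤ[T;T⁻¹] × ℤ[T;T⁻¹]) :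
    (List.replicate m x).foldl twistStep v =
      let e : ℤ := if x.positive then 1 else -1
      if x.middle then
        (Apow (-e * m) * v.1, hookWeight e m * v.1 + (-1) ^ m * Apow (3 * e * m) * v.2)
      else
        (hookWeight e m * v.2 + (-1) ^ m * Apow (3 * e * m) * v.1, Apow (-e * m) * v.2) := by
  have hweight : ∀ b : Bool, smoothingWeight b = Apow (if b then 1 else -1) := by
    intro b
    cases b <;> rfl
  have hnot : (if (!x.positive) = true then (1 : ℤ) else -1) = -(if x.positive then 1 else -1) := by
    cases x.positive <;> rfl
  induction m with
  | zero => cases hm : x.middle <;> simp [hookWeight, qInt, Apow_zero]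
  | succ m ih =>
    rw [List.replicate_succ', List.foldl_append, ih]
    simp only [List.foldl_cons, List.foldl_nil, twistStep, hweight, hnot]
    generalize (if x.positive then (1 : ℤ) else -1) = e
    have h1 : Apow (-e * (m + 1 : ℕ)) = Apow (-e) * Apow (-e * m) := by
      rw [← Apow_add]
      congr 1
      push_cast
      ring
    have h2 : Apow (3 * e * (m + 1 : ℕ)) = Apow e ^ 3 * Apow (3 * e * m) := by
      rw [Apow_pow, ← Apow_add]
      congr 1
      push_cast
      ring
    have h3 : Apow (3 * e) = Apow e ^ 3 := by
      rw [Apow_pow]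
      rfl
    rw [hookWeight_succ, h1, h2, h3]
    cases x.middle <;> simp only [if_true, if_false, Bool.false_eq_true, Prod.mk.injEq] <;>
      constructor <;> ring

/-- The relation between the coefficients of a twist box: closing it up gives a multiple of an
untwisted strand. -/
theorem Apow_add_dLoop_mul_hookWeight {e : ℤ} (he : e = 1 ∨ e = -1) (m : ℕ) :
    Apow (-e * m) + dLoop * hookWeight e m = (-1) ^ m * Apow (3 * e * m) := by
  -- The loop value is invariant under A ↦ A⁻¹, so one computation serves both signs.
  have hd : dLoop = -Apow (2 * e) - Apow (-(2 * e)) := by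
    rcases he with rfl | rfl
    · rfl
    · rw [dLoop]
      norm_num
      ring
  have hgeom : qInt m (-Apow (4 * e)) * (1 + Apow (4 * e)) = 1 - (-1) ^ m * Apow (m * (4 * e)) := by
    have := geom_sum_mul_neg (-Apow (4 * e)) m
    rw [neg_Apow_pow, sub_neg_eq_add] at this
    exact this
  have hdh : dLoop * hookWeight e m =
      -(Apow (-e * m) * (qInt m (-Apow (4 * e)) * (1 + Apow (4 * e)))) := by
    have h1 : Apow (e * (2 - m)) = Apow (2 * e) * Apow (-e * m) := by
      rw [← Apow_add]
      congr 1
      ring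
    have h2 : Apow (-(2 * e)) * Apow (2 * e) = 1 := by
      rw [← Apow_add, neg_add_cancel, Apow_zero]
    have h3 : Apow (4 * e) = Apow (2 * e) * Apow (2 * e) := by
      rw [← Apow_add]
      congr 1
      ring
    rw [hookWeight, hd, h1]
    linear_combination (-Apow (-e * m) * qInt m (-Apow (4 * e))) * h2 +
      (Apow (-e * m) * qInt m (-Apow (4 * e))) * h3
  rw [hdh, hgeom, mul_sub, mul_one, mul_left_comm, ← Apow_add,
    show -e * m + m * (4 * e) = 3 * e * m by ring]
  ring

/-! ### Tilings and their recursion -/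

/-- The lists with entries `1` and `2` whose sum is `n`. -/
def tilingLists : ℕ → Finset (List ℕ)
  | 0 => {[]}
  | 1 => {[1]}
  | n + 2 => (tilingLists (n + 1)).image (· ++ [1]) ∪ (tilingLists n).image (· ++ [2])

theorem mem_tilingLists (n : ℕ) (l : List ℕ) :
    l ∈ tilingLists n ↔ (∀ b ∈ l, b = 1 ∨ b = 2) ∧ l.sum = n := by
  induction n using Nat.strong_induction_on generalizing l with
  | _ n ih =>
    rcases List.eq_nil_or_concat' l with rfl | ⟨l, b, rfl⟩
    · match n with
      | 0 => simp [tilingLists]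
      | 1 => simp [tilingLists]
      | n + 2 => simp [tilingLists]
    · match n with
      | 0 =>
        simp only [tilingLists, Finset.mem_singleton, List.append_eq_nil_iff, List.cons_ne_nil,
          and_false, false_iff, List.sum_append, List.sum_singleton, not_and]
        intro h
        have := h b (by simp)
        omega
      | 1 =>
        have h0 := ih 0 (by omega) l
        simp only [tilingLists, Finset.mem_singleton] at h0
        have hmem : l ++ [b] ∈ tilingLists 1 ↔ l = [] ∧ b = 1 := by
          simp [tilingLists, List.append_eq_singleton_iff]
        simp only [hmem, h0, List.mem_append, List.sum_append, List.sum_singleton,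
          List.mem_singleton, or_imp, forall_and, forall_eq]
        constructor
        · rintro ⟨⟨h, h'⟩, rfl⟩
          exact ⟨⟨h, .inl rfl⟩, by omega⟩
        · rintro ⟨⟨h, rfl | rfl⟩, h'⟩
          · exact ⟨⟨h, by omega⟩, rfl⟩
          · omega
      | n + 2 =>
        have h1 := ih (n + 1) (by omega) l
        have h2 := ih n (by omega) l
        have hmem : l ++ [b] ∈ tilingLists (n + 2) ↔
            (l ∈ tilingLists (n + 1) ∧ b = 1) ∨ (l ∈ tilingLists n ∧ b = 2) := by
          simp only [tilingLists, Finset.mem_union, Finset.mem_image]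
          constructor
          · rintro (⟨l', h, h'⟩ | ⟨l', h, h'⟩)
            · obtain ⟨rfl, h'⟩ := List.append_inj' h' rfl
              exact .inl ⟨h, by simpa using h'.symm⟩
            · obtain ⟨rfl, h'⟩ := List.append_inj' h' rfl
              exact .inr ⟨h, by simpa using h'.symm⟩
          · rintro (⟨h, rfl⟩ | ⟨h, rfl⟩)
            exacts [.inl ⟨l, h, rfl⟩, .inr ⟨l, h, rfl⟩]
        simp only [hmem, h1, h2, List.mem_append, List.sum_append, List.sum_singleton,
          List.mem_singleton, or_imp, forall_and, forall_eq]
        constructor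
        · rintro (⟨⟨h, h'⟩, rfl⟩ | ⟨⟨h, h'⟩, rfl⟩)
          · exact ⟨⟨h, .inl rfl⟩, by omega⟩
          · exact ⟨⟨h, .inr rfl⟩, by omega⟩
        · rintro ⟨⟨h, rfl | rfl⟩, h'⟩
          · exact .inl ⟨⟨h, by omega⟩, rfl⟩
          · exact .inr ⟨⟨h, by omega⟩, rfl⟩

/-- The weight of the tiling of a strip by tiles whose lengths are listed by `l`, placed after the
cell `k`. -/
def tileListWeight {R : Type*} [CommRing R] (single domino : ℕ → R) : ℕ → List ℕ → R
  | _, [] => 1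
  | k, b :: l =>
    (if b = 1 then single (k + 1) else domino (k + 1)) * tileListWeight single domino (k + b) l

theorem tileListWeight_append_singleton {R : Type*} [CommRing R] (single domino : ℕ → R) (k : ℕ)
    (l : List ℕ) (b : ℕ) :
    tileListWeight single domino k (l ++ [b]) = tileListWeight single domino k l *
      (if b = 1 then single (k + l.sum + 1) else domino (k + l.sum + 1)) := by
  induction l generalizing k with
  | nil => simp [tileListWeight]
  | cons c l ih =>
    simp only [List.cons_append, tileListWeight, ih, List.sum_cons]
    rw [mul_assoc, add_assoc k c]

theorem prod_eq_tileListWeight {R : Type*} [CommRing R] (single domino : ℕ → R) (k : ℕ)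
    (l : List ℕ) :
    (∏ i : Fin l.length, if l[i] = 1 then single (k + (l.take i).sum + 1)
      else domino (k + (l.take i).sum + 1)) = tileListWeight single domino k l := by
  induction l generalizing k with
  | nil => simp [tileListWeight]
  | cons b l ih =>
    rw [tileListWeight, ← ih]
    erw [Fin.prod_univ_succ]
    simp [add_assoc]

theorem tilingWeight_eq_tileListWeight {R : Type*} [CommRing R] (single domino : ℕ → R) {n : ℕ}
    (c : Composition n) :
    tilingWeight single domino c = tileListWeight single domino 0 c.blocks := by
  rw [← prod_eq_tileListWeight]
  simp only [zero_add]
  rfl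

/-- Passing from compositions to lists makes removal of the last tile an operation on lists, free of
the dependence on `n`. -/
theorem sum_tilings_eq {R : Type*} [CommRing R] (single domino : ℕ → R) (n : ℕ) :
    ∑ c ∈ tilings n, tilingWeight single domino c =
      ∑ l ∈ tilingLists n, tileListWeight single domino 0 l := by
  refine Finset.sum_bij (fun c _ => c.blocks) ?_ ?_ ?_ ?_
  · intro c hc
    rw [mem_tilingLists]
    refine ⟨fun b hb => ?_, c.blocks_sum⟩
    obtain ⟨i, hi, rfl⟩ := List.getElem_of_mem hb
    exact (Finset.mem_filter.1 hc).2 ⟨i, hi⟩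
  · intro c _ c' _ h
    exact Composition.ext h
  · intro l hl
    rw [mem_tilingLists] at hl
    refine ⟨⟨l, fun {i} hi => by rcases hl.1 i hi with rfl | rfl <;> norm_num, hl.2⟩, ?_, rfl⟩
    exact Finset.mem_filter.2 ⟨Finset.mem_univ _, fun i => hl.1 _ (List.getElem_mem _)⟩
  · intro c _
    exact tilingWeight_eq_tileListWeight single domino c

theorem sum_tilings_zero {R : Type*} [CommRing R] (single domino : ℕ → R) :
    ∑ c ∈ tilings 0, tilingWeight single domino c = 1 := by
  simp [sum_tilings_eq, tilingLists, tileListWeight]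

theorem sum_tilings_one {R : Type*} [CommRing R] (single domino : ℕ → R) :
    ∑ c ∈ tilings 1, tilingWeight single domino c = single 1 := by
  simp [sum_tilings_eq, tilingLists, tileListWeight]

/-- Removing the last tile: the tiling sums satisfy the recursion of a continuant. -/
theorem sum_tilings_add_two {R : Type*} [CommRing R] (single domino : ℕ → R) (n : ℕ) :
    ∑ c ∈ tilings (n + 2), tilingWeight single domino c =
      single (n + 2) * ∑ c ∈ tilings (n + 1), tilingWeight single domino c +
        domino (n + 1) * ∑ c ∈ tilings n, tilingWeight single domino c := by
  simp only [sum_tilings_eq]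
  rw [tilingLists, Finset.sum_union, Finset.sum_image, Finset.sum_image, Finset.mul_sum,
    Finset.mul_sum]
  · congr 1
    all_goals
      refine Finset.sum_congr rfl fun l hl => ?_
      rw [mem_tilingLists] at hl
      simp [tileListWeight_append_singleton, hl.2, mul_comm]
  · intro l _ l' _ h
    simpa using h
  · intro l _ l' _ h
    simpa using h
  · rw [Finset.disjoint_left]
    intro l h h'
    obtain ⟨l₁, _, rfl⟩ := Finset.mem_image.1 h
    obtain ⟨l₂, _, h₂⟩ := Finset.mem_image.1 h'
    simp at h₂

/-! ### The recursion for the standard diagram -/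

theorem negOnePow_cast_eq (a : ℤ) :
    (((a.negOnePow : ℤˣ) : ℤ) : ℤ[T;T⁻¹]) = (-1) ^ a.natAbs := by
  obtain ⟨m, rfl | rfl⟩ := a.eq_nat_or_neg <;> simp [Int.negOnePow_neg]

/-- The sign of the twists in the twist box number `k`. -/
def boxSign (k : ℕ) (ak : ℤ) : ℤ := (-1) ^ (k + 1) * ak.sign

theorem boxSign_eq (k : ℕ) {ak : ℤ} (h : ak ≠ 0) : boxSign k ak = 1 ∨ boxSign k ak = -1 := by
  rw [boxSign]
  rcases neg_one_pow_eq_or ℤ (k + 1) with h1 | h1 <;>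
    rcases lt_or_gt_of_ne h with h2 | h2 <;>
    simp [h1, Int.sign_eq_one_of_pos, Int.sign_eq_neg_one_of_neg, h2]

theorem boxSign_mul_natAbs (k : ℕ) (ak : ℤ) :
    boxSign k ak * ak.natAbs = (-1) ^ (k + 1) * ak := by
  rw [boxSign, mul_assoc, Int.natCast_natAbs, Int.sign_mul_abs]

theorem foldl_twistBox (k : ℕ) {ak : ℤ} (h : ak ≠ 0) (v : ℤ[T;T⁻¹] × ℤ[T;T⁻¹]) :
    (twistBox k ak).foldl twistStep v =
      let e := boxSign k ak
      let m := ak.natAbs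
      if Odd k then
        (Apow (-e * m) * v.1, hookWeight e m * v.1 + (-1) ^ m * Apow (3 * e * m) * v.2)
      else
        (hookWeight e m * v.2 + (-1) ^ m * Apow (3 * e * m) * v.1, Apow (-e * m) * v.2) := by
  have he : (if decide (0 < (-1 : ℤ) ^ (k + 1) * ak.sign) = true then (1 : ℤ) else -1) =
      boxSign k ak := by
    change (if decide (0 < boxSign k ak) = true then (1 : ℤ) else -1) = boxSign k ak
    rcases boxSign_eq k h with h | h <;> simp [h]
  rw [twistBox, foldl_twistStep_replicate]
  simp only [decide_eq_true_eq] at he ⊢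
  simp only [he]

/-- The coefficients of the two matchings in the first `n` twist boxes. -/
def boxState (a : ℕ → ℤ) (n : ℕ) : ℤ[T;T⁻¹] × ℤ[T;T⁻¹] :=
  ((List.range n).flatMap fun i => twistBox (i + 1) (a (i + 1))).foldl twistStep (1, 0)

theorem boxState_succ (a : ℕ → ℤ) (n : ℕ) :
    boxState a (n + 1) = (twistBox (n + 1) (a (n + 1))).foldl twistStep (boxState a n) := by
  simp [boxState, List.range_succ, List.foldl_append]

theorem kauffmanBracket_standardDiagram (n : ℕ) (a : ℕ → ℤ) :
    (standardDiagram n a).kauffmanBracket =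
      formalBracket [] (boxState a n) (!decide (Odd n)) := by
  rw [standardDiagram, kauffmanBracket_fourPlat, boxState, ← formalBracket_eq_foldl]
  simp [formalBracket]

theorem hookWeight_boxSign (k : ℕ) (ak : ℤ) :
    hookWeight (boxSign k ak) ak.natAbs =
      Apow ((-1) ^ (k + 1) * (2 * ak.sign - ak)) *
        qInt ak.natAbs (-Apow ((-1) ^ (k + 1) * (4 * ak.sign))) := by
  rw [hookWeight, mul_sub, boxSign_mul_natAbs, boxSign]
  congr 2
  · ring_nf
  · congr 1
    ring_nf

theorem singleWeight_add_two (a : ℕ → ℤ) (k : ℕ) :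
    singleWeight a (k + 2) = hookWeight (boxSign (k + 2) (a (k + 2))) (a (k + 2)).natAbs := by
  -- The exponents of -1 are k + 1 in the tile weight and k + 3 in `hookWeight_boxSign`; only their
  -- parity matters.
  rw [singleWeight, if_neg (by omega), hookWeight_boxSign, Nat.add_sub_cancel_right (k + 1) 1,
    pow_add _ (k + 1) 2, neg_one_sq, mul_one]

/-- A domino stands for box `k` turned into kinks and box `k + 1` smoothed to the identity. -/
theorem dominoWeight_eq (a : ℕ → ℤ) (k : ℕ) :
    dominoWeight a k = (-1) ^ (a k).natAbs * Apow (3 * boxSign k (a k) * (a k).natAbs) *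
      Apow (-boxSign (k + 1) (a (k + 1)) * (a (k + 1)).natAbs) := by
  rw [dominoWeight, negOnePow_cast_eq, mul_assoc (3 : ℤ), neg_mul, boxSign_mul_natAbs,
    boxSign_mul_natAbs, mul_assoc, ← Apow_add]
  congr 2
  ring

theorem kauffmanBracket_standardDiagram_zero (a : ℕ → ℤ) :
    (standardDiagram 0 a).kauffmanBracket = 1 := by
  simp [kauffmanBracket_standardDiagram, formalBracket_nil, boxState]

theorem kauffmanBracket_standardDiagram_one (a : ℕ → ℤ) (h : a 1 ≠ 0) :
    (standardDiagram 1 a).kauffmanBracket = singleWeight a 1 := by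
  have h0 : boxState a 0 = (1, 0) := rfl
  have hs := boxSign_mul_natAbs 1 (a 1)
  have hh := hookWeight_boxSign 1 (a 1)
  norm_num at hs hh
  rw [kauffmanBracket_standardDiagram, formalBracket_nil, boxState_succ, zero_add,
    foldl_twistBox 1 h, h0, singleWeight, if_pos rfl]
  simp [hh, hs]
  ring_nf

/-- Removing the last two twist boxes. -/
theorem kauffmanBracket_standardDiagram_add_two (n : ℕ) (a : ℕ → ℤ) (h₁ : a (n + 1) ≠ 0)
    (h₂ : a (n + 2) ≠ 0) :
    (standardDiagram (n + 2) a).kauffmanBracket =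
      singleWeight a (n + 2) * (standardDiagram (n + 1) a).kauffmanBracket +
        dominoWeight a (n + 1) * (standardDiagram n a).kauffmanBracket := by
  have r₁ := Apow_add_dLoop_mul_hookWeight (boxSign_eq (n + 1) h₁) (a (n + 1)).natAbs
  have r₂ := Apow_add_dLoop_mul_hookWeight (boxSign_eq (n + 2) h₂) (a (n + 2)).natAbs
  simp only [kauffmanBracket_standardDiagram, singleWeight_add_two, dominoWeight_eq,
    formalBracket_nil]
  have s₁ := (boxState_succ a n).trans (foldl_twistBox (n + 1) h₁ _)
  have s₂ := (boxState_succ a (n + 1)).trans (foldl_twistBox (n + 2) h₂ _)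
  dsimp only at s₁ s₂
  -- With each kink factor κ written as α + d h, the recursion becomes a polynomial identity in α,
  -- h, d and the coefficients in `boxState a n`.
  rw [← r₁] at s₁ ⊢
  rw [← r₂] at s₂
  rw [s₂, s₁]
  -- The parity of `n` only exchanges the roles of the two matchings.
  rcases Nat.even_or_odd n with hn | hn
  · have o₁ : Odd (n + 1) := hn.add_one
    have o₂ : ¬ Odd (n + 2) := Nat.not_odd_iff_even.2 (hn.add even_two)
    have o₀ : ¬ Odd n := by simpa using hn
    simp only [o₀, o₁, o₂, if_true, if_false, decide_true, decide_false, Bool.not_true,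
      Bool.not_false, Bool.false_eq_true]
    ring
  · have o₁ : ¬ Odd (n + 1) := by simpa [Nat.odd_add_one] using hn
    have o₂ : Odd (n + 2) := hn.add_even even_two
    simp only [hn, o₁, o₂, if_true, if_false, decide_true, decide_false, Bool.not_true,
      Bool.not_false, Bool.false_eq_true]
    ring

end

theorem corollary5p3 (n : ℕ) (hn : 1 ≤ n) (a : ℕ → ℤ) (ha : ∀ k ∈ Finset.Icc 1 n, a k ≠ 0) :
    (standardDiagram n a).kauffmanBracket =
      ∑ c ∈ tilings n, tilingWeight (singleWeight a) (dominoWeight a) c := by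
  clear hn
  induction n using Nat.twoStepInduction with
  -- The empty diagram of boxes closes to one circle; its value 1 is the weight of the empty tiling.
  | zero => rw [kauffmanBracket_standardDiagram_zero, sum_tilings_zero]
  | one =>
    rw [kauffmanBracket_standardDiagram_one a (ha 1 (by simp)), sum_tilings_one]
  | more n ih₁ ih₂ =>
    rw [kauffmanBracket_standardDiagram_add_two n a (ha _ (by simp)) (ha _ (by simp)),
      sum_tilings_add_two,
      ih₁ fun k hk => ha k (Finset.Icc_subset_Icc_right (by omega) hk),
      ih₂ fun k hk => ha k (Finset.Icc_subset_Icc_right (by omega) hk)]
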